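/- Consider two-qubit states $\rho$ (subsystems $A$, $B$), with measurements performed on $B$. For a POVM $\Pi=\{\Pi_j\}$ (finitely many positive semidefinite $2\times 2$ matrices with $\sum_j\Pi_j=1$) put $p_j=\mathrm{Tr}[(1\otimes\Pi_j)\rho]$, $\rho^A_j=\mathrm{Tr}_B[(1\otimes\Pi_j)\rho]/p_j$ and $S^A(\Pi)=\sum_j p_jS(\rho^A_j)$, where $S$ is the von Neumann entropy (with $\log_2$) and outcomes with $p_j=0$ contribute $0$. A POVM is called optimal if it minimizes $S^A$ over all POVMs. The quantum discord is $D(\rho)=I(\rho)-\max_\Pi[S(\rho_A)-S^A(\Pi)]$ with $I(\rho)=S(\rho_A)+S(\rho_B)-S(\rho)$. Let $\rho$ be an $X$-state: there are unitaries $U,V$ such that $\tau=(U\otimes V)\rho(U\otimes V)^\dagger$ has, in the computational basis $|00\rangle,|01\rangle,|10\rangle,|11\rangle$, nonzero entries only on the diagonal and the anti-diagonal, the anti-diagonal entries being real. With the Pauli matrices $\sigma_0=1,\sigma_1,\sigma_2,\sigma_3$ put $m_{ab}=\mathrm{Tr}[\tau(\sigma_a\otimes\sigma_b^*)]$, so that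 $\tau=\frac14\sum_{a,b}m_{ab}\,\sigma_a\otimes\sigma_b^*$. Assume $|m_{03}|<1$ (i.e. $\rho_B$ is not pure), and let $$a_x=\frac{|m_{11}|}{\sqrt{1-m_{03}^2}},\quad a_y=\frac{|m_{22}|}{\sqrt{1-m_{03}^2}},\quad a_z=\frac{|m_{33}-m_{03}m_{30}|}{1-m_{03}^2},\quad z_c=\frac{m_{30}-m_{03}m_{33}}{1-m_{03}^2}$$ be the semi-axes and the $z$-coordinate of the centre of the correlation ellipsoid. Assume the convention $a_x\ge a_y$, and that the ellipsoid is centered at the origin: $z_c=0$, i.e. $m_{30}=m_{03}m_{33}$. Nothing is assumed on the position $z_I=m_{30}$ of the reduced state inside the ellipsoid. Let the projection along $z$ (resp. $x$) be the von Neumann measurement $\{\frac12V^\dagger(1\pm\sigma_3)V\}$ (resp. $\{\frac12V^\dagger(1\pm\sigma_1)V\}$) on $B$, and let $$S_2(r)=-\tfrac{1+r}2\log_2\tfrac{1+r}2-\tfrac{1-r}2\log_2\tfrac{1-r}2 .$$ (i) If $a_x<a_z$, the projection along $z$ is an optimal POVM, the projection along $x$ gives a strictly larger $S^A$, and $S^A_{\min}=\min_\Pi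 S^A(\Pi)=S_2(a_z)$. (ii) If $a_x>a_z$, the projection along $x$ is an optimal POVM, the projection along $z$ gives a strictly larger $S^A$, and $S^A_{\min}=S_2\big(\sqrt{m_{11}^2+m_{30}^2}\big)$. In both cases the discord has the closed form $$D(\rho)=S_2(|m_{03}|)+\sum_{j=0}^3\lambda_j\log_2\lambda_j+S^A_{\min},$$ where the $\lambda_j$ are the four numbers $\frac{1+m_{33}}4\pm\frac14\sqrt{(m_{11}+m_{22})^2+(m_{30}+m_{03})^2}$ and $\frac{1-m_{33}}4\pm\frac14\sqrt{(m_{11}-m_{22})^2+(m_{30}-m_{03})^2}$, and $0\log_2 0=0$. -/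

import Mathlib

open scoped Matrix Kronecker ComplexOrder

noncomputable section

namespace TwoQubit

/-- One-qubit operators, in the computational basis. -/
abbrev QMat := Matrix (Fin 2) (Fin 2) ℂ

/-- Two-qubit operators, in the computational basis `|jk⟩`; the first index belongs to subsystem A,
the second one to subsystem B. -/
abbrev QQMat := Matrix (Fin 2 × Fin 2) (Fin 2 × Fin 2) ℂ

/-- Density operators. -/
def IsDensity {n : Type*} [Fintype n] (ρ : Matrix n n ℂ) : Prop :=
  ρ.PosSemidef ∧ ρ.trace = 1

/-- The Pauli matrices `σ₀ = 1, σ₁, σ₂, σ₃`. -/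
def pauli : Fin 4 → QMat :=
  ![1, !![0, 1; 1, 0], !![0, -Complex.I; Complex.I, 0], !![1, 0; 0, -1]]

/-- The entrywise complex conjugate `σ_a^*`. -/
def pauliConj (a : Fin 4) : QMat := (pauli a).map (starRingEnd ℂ)

/-- Entry `M_ab` of the Mueller matrix of a two-qubit state, that is, the coefficients in
`ρ = (1/4) ∑ M_ab σ_a ⊗ σ_b^*`. -/
def mueller (ρ : QQMat) (a b : Fin 4) : ℝ :=
  (Matrix.trace (ρ * (pauli a ⊗ₖ pauliConj b))).re

/-- The partial trace over subsystem B. -/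
def traceB (ρ : QQMat) : QMat := fun i j => ∑ k, ρ (i, k) (j, k)

/-- The partial trace over subsystem A. -/
def traceA (ρ : QQMat) : QMat := fun i j => ∑ k, ρ (k, i) (k, j)

open Classical in
/-- The von Neumann entropy `-∑ λ log₂ λ` of a Hermitian matrix, `λ` running over the eigenvalues
with multiplicity. -/
def entropy {n : Type*} [Fintype n] [DecidableEq n] (ρ : Matrix n n ℂ) : ℝ :=
  if h : ρ.IsHermitian then ∑ i, -(h.eigenvalues i * Real.logb 2 (h.eigenvalues i)) else 0

/-- Finite POVMs on a qubit. -/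
def IsPOVM {k : ℕ} (E : Fin k → QMat) : Prop :=
  (∀ j, (E j).PosSemidef) ∧ ∑ j, E j = 1

/-- The probability of the outcome `E` when it is measured on B. -/
def outcomeProb (ρ : QQMat) (E : QMat) : ℝ :=
  (Matrix.trace (((1 : QMat) ⊗ₖ E) * ρ)).re

/-- The normalized state of A after the outcome `E` on B. -/
def condState (ρ : QQMat) (E : QMat) : QMat :=
  (((outcomeProb ρ E)⁻¹ : ℝ) : ℂ) • traceB (((1 : QMat) ⊗ₖ E) * ρ)

/-- The average conditional entropy `∑_j p_j S(ρ_j^A)` after the measurement `E` on B. An outcome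
of probability zero contributes zero. -/
def condEntropy (ρ : QQMat) {k : ℕ} (E : Fin k → QMat) : ℝ :=
  ∑ j, outcomeProb ρ (E j) * entropy (condState ρ (E j))

/-- The values of the average conditional entropy over all POVMs on B. -/
def condEntropyValues (ρ : QQMat) : Set ℝ :=
  {s | ∃ (k : ℕ) (E : Fin k → QMat), IsPOVM E ∧ s = condEntropy ρ E}

/-- A POVM on B is optimal if it minimizes the average conditional entropy among all POVMs. -/
def IsOptimalPOVM (ρ : QQMat) {k : ℕ} (E : Fin k → QMat) : Prop :=
  IsPOVM E ∧ ∀ (l : ℕ) (F : Fin l → QMat), IsPOVM F → condEntropy ρ E ≤ condEntropy ρ F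

/-- The mutual information. -/
def mutualInformation (ρ : QQMat) : ℝ :=
  entropy (traceB ρ) + entropy (traceA ρ) - entropy ρ

/-- The classical correlation, for measurements on B. -/
def classicalCorrelation (ρ : QQMat) : ℝ :=
  sSup {c | ∃ (k : ℕ) (E : Fin k → QMat),
    IsPOVM E ∧ c = entropy (traceB ρ) - condEntropy ρ E}

/-- The quantum discord, for measurements on B. -/
def discord (ρ : QQMat) : ℝ := mutualInformation ρ - classicalCorrelation ρ

/-- The state `(U ⊗ V) ρ (U ⊗ V)†`. -/
def localConj (U V : QMat) (ρ : QQMat) : QQMat := (U ⊗ₖ V) * ρ * (U ⊗ₖ V)ᴴ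

/-- Two-qubit matrices of shape `X`, with real anti-diagonal entries: the only nonzero entries are
on the diagonal (both indices agree) or on the anti-diagonal (both indices differ). -/
def IsRealX (ρ : QQMat) : Prop :=
  (∀ i j i' j' : Fin 2, ¬ (i = i' ↔ j = j') → ρ (i, j) (i', j') = 0) ∧
    (∀ i j i' j' : Fin 2, i ≠ i' → j ≠ j' → (ρ (i, j) (i', j')).im = 0)

/-- Semi-axis along `x` of the correlation ellipsoid of a real `X`-state. -/
def semiaxisX (ρ : QQMat) : ℝ := |mueller ρ 1 1| / √(1 - mueller ρ 0 3 ^ 2)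

/-- Semi-axis along `y` of the correlation ellipsoid of a real `X`-state. -/
def semiaxisY (ρ : QQMat) : ℝ := |mueller ρ 2 2| / √(1 - mueller ρ 0 3 ^ 2)

/-- Semi-axis along `z` of the correlation ellipsoid of a real `X`-state. -/
def semiaxisZ (ρ : QQMat) : ℝ :=
  |mueller ρ 3 3 - mueller ρ 0 3 * mueller ρ 3 0| / (1 - mueller ρ 0 3 ^ 2)

/-- The `z`-coordinate of the centre of the correlation ellipsoid of a real `X`-state. -/
def centerZ (ρ : QQMat) : ℝ :=
  (mueller ρ 3 0 - mueller ρ 0 3 * mueller ρ 3 3) / (1 - mueller ρ 0 3 ^ 2)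

/-- The von Neumann projection on B along the axis `a`, in the frame rotated by `V`: its elements
are `V† (1 ± σ_a^*) V / 2`. -/
def axisProjection (V : QMat) (a : Fin 4) : Fin 2 → QMat :=
  ![(1 / 2 : ℂ) • (Vᴴ * (1 + pauliConj a) * V), (1 / 2 : ℂ) • (Vᴴ * (1 - pauliConj a) * V)]

/-- The entropy of a qubit state whose Bloch vector has length `r`. -/
def blochEntropy (r : ℝ) : ℝ :=
  -((1 + r) / 2 * Real.logb 2 ((1 + r) / 2)) - (1 - r) / 2 * Real.logb 2 ((1 - r) / 2)

/-- The four eigenvalues of a real `X`-state in terms of its Mueller matrix. -/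
def spectrumX (ρ : QQMat) : Fin 4 → ℝ :=
  ![(1 + mueller ρ 3 3) / 4
      + √((mueller ρ 1 1 + mueller ρ 2 2) ^ 2 + (mueller ρ 3 0 + mueller ρ 0 3) ^ 2) / 4,
    (1 - mueller ρ 3 3) / 4
      + √((mueller ρ 1 1 - mueller ρ 2 2) ^ 2 + (mueller ρ 3 0 - mueller ρ 0 3) ^ 2) / 4,
    (1 - mueller ρ 3 3) / 4
      - √((mueller ρ 1 1 - mueller ρ 2 2) ^ 2 + (mueller ρ 3 0 - mueller ρ 0 3) ^ 2) / 4,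
    (1 + mueller ρ 3 3) / 4
      - √((mueller ρ 1 1 + mueller ρ 2 2) ^ 2 + (mueller ρ 3 0 + mueller ρ 0 3) ^ 2) / 4]

/-- The part `S(ρ_B) - S(ρ_AB)` of the discord of a real `X`-state, in closed form. -/
def entropyGapX (ρ : QQMat) : ℝ :=
  blochEntropy |mueller ρ 0 3| + ∑ i, spectrumX ρ i * Real.logb 2 (spectrumX ρ i)

end TwoQubit

end

/-! Local unitaries reduce the problem to a real X-state with Mueller entries m = m₀₃, t = m₃₃, x =
m₁₁, y = m₂₂, and centring forces m₃₀ = m t. An effect E on B with diagonal (e₀, e₁) has probability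
p = ((1+m)e₀ + (1-m)e₁)/2. Put q = ((1+m)e₀ - (1-m)e₁)/2. The z-component of the unnormalized Bloch
vector of A is then exactly t q. Since y² ≤ x² and |E₀₁|² ≤ e₀e₁, its transverse part has squared
length at most x² e₀e₁, and p² - q² = (1-m²) e₀e₁. Hence, with a = x²/(1-m²) = a_x² and u = q/p ∈
[-1, 1], the conditional Bloch vector has squared length at most a - (a - t²)u²
(`outcomeBlochSq_le`), while the p-average of u is m for every POVM.

If a ≤ t², this bound never exceeds t², and monotonicity of the entropy settles the matter outcome
by outcome (`blochEntropy_abs_le_condEntropy`). If a > t², the entropy at radius √(a - (a - t²)u²)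
is convex in u (`ellipseEntropy_convexOn`, which needs a ≤ 1, supplied by `xState_bounds`). Jensen
then gives its value at u = m, where the squared radius is x² + m²t²
(`blochEntropy_sqrt_le_condEntropy`). The z- and x-projections attain the respective bounds. The
discord follows from the minimum and the block-diagonal spectrum (`optimal_of_forall_le`). -/

namespace TwoQubit

/-! ### Qubit entropy: monotonicity in the radius and convexity along an ellipse -/

lemma blochEntropy_eq_binEntropy (r : ℝ) :
    blochEntropy r = Real.binEntropy ((1 + r) / 2) / Real.log 2 := by
  have h : 1 - (1 + r) / 2 = (1 - r) / 2 := by ring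
  rw [Real.binEntropy_eq_negMulLog_add_negMulLog_one_sub, h]
  simp only [blochEntropy, Real.negMulLog, Real.logb]
  ring

lemma blochEntropy_neg (r : ℝ) : blochEntropy (-r) = blochEntropy r := by
  simp only [blochEntropy, sub_neg_eq_add, ← sub_eq_add_neg]
  ring

lemma blochEntropy_abs (r : ℝ) : blochEntropy |r| = blochEntropy r := by
  rcases abs_choice r with h | h <;> rw [h]
  exact blochEntropy_neg r

lemma blochEntropy_strictAntiOn : StrictAntiOn blochEntropy (Set.Icc 0 1) := by
  intro r hr s hs hrs
  rw [blochEntropy_eq_binEntropy, blochEntropy_eq_binEntropy]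
  refine div_lt_div_of_pos_right ?_ (Real.log_pos one_lt_two)
  refine Real.binEntropy_strictAntiOn ?_ ?_ (by linarith)
  · constructor <;> linarith [hr.1, hr.2]
  · constructor <;> linarith [hs.1, hs.2]

/-- The inequality `2 r ≤ log ((1 + r) / (1 - r))`, that is `r ≤ artanh r`. -/
lemma two_mul_le_log_sub_log {r : ℝ} (h0 : 0 ≤ r) (h1 : r < 1) :
    2 * r ≤ Real.log (1 + r) - Real.log (1 - r) := by
  have h := Real.hasSum_log_sub_log_of_abs_lt_one (abs_lt.2 ⟨by linarith, h1⟩)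
  -- All terms of the series 2 ∑ r^(2k+1)/(2k+1) are nonnegative; the first one is 2r.
  have := sum_le_hasSum {0} (fun i _ => by positivity) h
  simpa using this

/-- The entropy of a Bloch vector of squared length `a - b u²`. -/
noncomputable def ellipseEntropy (a b u : ℝ) : ℝ := Real.binEntropy ((1 + √(a - b * u ^ 2)) / 2)

lemma hasDerivAt_sqrt_sub_mul_sq {a b u : ℝ} (h : 0 < a - b * u ^ 2) :
    HasDerivAt (fun u => √(a - b * u ^ 2)) (-(b * u) / √(a - b * u ^ 2)) u := by
  have h1 : HasDerivAt (fun u : ℝ => a - b * u ^ 2) (-(b * (2 * u))) u := by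
    simpa using ((hasDerivAt_pow 2 u).const_mul b).const_sub a
  convert h1.sqrt h.ne' using 1
  have := Real.sqrt_pos.2 h
  field_simp

lemma hasDerivAt_ellipseEntropy {a b u : ℝ} (h : 0 < a - b * u ^ 2) (h1 : a - b * u ^ 2 < 1) :
    HasDerivAt (ellipseEntropy a b)
      (b / 2 * u * (Real.log (1 + √(a - b * u ^ 2)) - Real.log (1 - √(a - b * u ^ 2)))
        / √(a - b * u ^ 2)) u := by
  have hr := Real.sqrt_pos.2 h
  have hr1 : √(a - b * u ^ 2) < 1 := by rw [Real.sqrt_lt' one_pos]; simpa using h1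
  have hd := hasDerivAt_sqrt_sub_mul_sq h
  have hb := Real.hasDerivAt_binEntropy (p := (1 + √(a - b * u ^ 2)) / 2)
    (by positivity) (by intro hh; linarith)
  refine (hb.comp u ((hd.const_add 1).div_const 2)).congr_deriv ?_
  have e : 1 - (1 + √(a - b * u ^ 2)) / 2 = (1 - √(a - b * u ^ 2)) / 2 := by ring
  rw [e, Real.log_div (by linarith) two_ne_zero, Real.log_div (by linarith) two_ne_zero]
  field_simp
  ring

lemma hasDerivAt_deriv_ellipseEntropy {a b u : ℝ} (h : 0 < a - b * u ^ 2)
    (h1 : a - b * u ^ 2 < 1) :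
    HasDerivAt
      (fun u => b / 2 * u * (Real.log (1 + √(a - b * u ^ 2)) - Real.log (1 - √(a - b * u ^ 2)))
        / √(a - b * u ^ 2))
      (b / 2 * ((Real.log (1 + √(a - b * u ^ 2)) - Real.log (1 - √(a - b * u ^ 2)))
          * √(a - b * u ^ 2) ^ 2
        - b * u ^ 2 * (2 * √(a - b * u ^ 2) / (1 - √(a - b * u ^ 2) ^ 2)
          - (Real.log (1 + √(a - b * u ^ 2)) - Real.log (1 - √(a - b * u ^ 2)))))
        / √(a - b * u ^ 2) ^ 3) u := by
  have hr := Real.sqrt_pos.2 h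
  have hr1 : √(a - b * u ^ 2) < 1 := by rw [Real.sqrt_lt' one_pos]; simpa using h1
  have hd := hasDerivAt_sqrt_sub_mul_sq h
  have hl := ((hd.const_add 1).log (by positivity)).sub ((hd.const_sub 1).log (by linarith))
  refine ((((hasDerivAt_id' u).const_mul (b / 2)).mul hl).div hd hr.ne').congr_deriv ?_
  have e1 : 1 - √(a - b * u ^ 2) ≠ 0 := by linarith
  have e2 : 1 + √(a - b * u ^ 2) ≠ 0 := by positivity
  simp only [Pi.mul_apply, Pi.sub_apply]
  have e3 : 1 - √(a - b * u ^ 2) ^ 2 ≠ 0 := by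
    have : 1 - √(a - b * u ^ 2) ^ 2 = (1 - √(a - b * u ^ 2)) * (1 + √(a - b * u ^ 2)) := by ring
    rw [this]; exact mul_ne_zero e1 e2
  generalize √(a - b * u ^ 2) = r at *
  generalize Real.log (1 + r) = p
  generalize Real.log (1 - r) = q
  field_simp
  ring

/-- Write l for the difference of logarithms. Since a ≤ 1, b u² ≤ 1 - r²; when the factor
multiplying b u² is nonnegative, replacing b u² by 1 - r² bounds the bracket below by l - 2r, which
is nonnegative by `two_mul_le_log_sub_log`. -/
lemma deriv2_ellipseEntropy_nonneg {a b u r : ℝ} (ha : a ≤ 1) (hb : 0 ≤ b) (hr : 0 < r)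
    (hr1 : r < 1) (h : r ^ 2 = a - b * u ^ 2) :
    0 ≤ b / 2 * ((Real.log (1 + r) - Real.log (1 - r)) * r ^ 2
        - b * u ^ 2 * (2 * r / (1 - r ^ 2) - (Real.log (1 + r) - Real.log (1 - r)))) / r ^ 3 := by
  have hl := two_mul_le_log_sub_log hr.le hr1
  set l := Real.log (1 + r) - Real.log (1 - r)
  have hu : b * u ^ 2 ≤ 1 - r ^ 2 := by linarith
  have hu0 : 0 ≤ b * u ^ 2 := by positivity
  have hr2 : 0 < 1 - r ^ 2 := by nlinarith
  suffices 0 ≤ l * r ^ 2 - b * u ^ 2 * (2 * r / (1 - r ^ 2) - l) by positivity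
  rcases le_total (2 * r / (1 - r ^ 2) - l) 0 with hn | hn
  · nlinarith [mul_nonneg hu0 (neg_nonneg.2 hn), mul_nonneg (by linarith : 0 ≤ l) (sq_nonneg r)]
  · have h3 := mul_le_mul_of_nonneg_right hu hn
    have h4 : (1 - r ^ 2) * (2 * r / (1 - r ^ 2) - l) = 2 * r - (1 - r ^ 2) * l := by
      field_simp
    nlinarith

lemma ellipseEntropy_monotoneOn {a b : ℝ} (ha : a ≤ 1) (hb : 0 ≤ b) :
    MonotoneOn (ellipseEntropy a b) (Set.Ici 0) := by
  intro u hu v _ huv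
  have h0 := Set.mem_Ici.1 hu
  have h1 : a - b * v ^ 2 ≤ a - b * u ^ 2 := by gcongr
  have h2 := Real.sqrt_le_sqrt h1
  have h3 : √(a - b * u ^ 2) ≤ 1 :=
    Real.sqrt_le_one.2 (by nlinarith [mul_nonneg hb (sq_nonneg u)])
  have h4 := Real.sqrt_nonneg (a - b * v ^ 2)
  exact Real.binEntropy_strictAntiOn.antitoneOn ⟨by linarith, by linarith⟩
    ⟨by linarith, by linarith⟩ (by linarith)

lemma ellipseEntropy_convexOn_unit {a b : ℝ} (ha : a ≤ 1) (hb : 0 < b) (hab : b ≤ a) :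
    ConvexOn ℝ (Set.Icc 0 1) (ellipseEntropy a b) := by
  -- The radius can be 1 at u = 0 (if a = 1) and 0 at u = 1 (if b = a), so derivatives are used only
  -- in the interior; continuity covers the endpoints.
  have key : ∀ u ∈ interior (Set.Icc (0 : ℝ) 1), 0 < a - b * u ^ 2 ∧ a - b * u ^ 2 < 1 := by
    intro u hu
    rw [interior_Icc] at hu
    have h1 : u ^ 2 < 1 := by nlinarith [hu.1, hu.2]
    have h2 : 0 < u ^ 2 := pow_pos hu.1 2
    constructor <;> nlinarith
  refine convexOn_of_hasDerivWithinAt2_nonneg (convex_Icc 0 1) ?_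
    (fun u hu => (hasDerivAt_ellipseEntropy (key u hu).1 (key u hu).2).hasDerivWithinAt)
    (fun u hu => (hasDerivAt_deriv_ellipseEntropy (key u hu).1 (key u hu).2).hasDerivWithinAt) ?_
  · unfold ellipseEntropy
    exact (Real.binEntropy_continuous.comp (by fun_prop)).continuousOn
  · intro u hu
    obtain ⟨h, h1⟩ := key u hu
    exact deriv2_ellipseEntropy_nonneg ha hb.le (Real.sqrt_pos.2 h)
      (by rw [Real.sqrt_lt' one_pos]; simpa using h1) (Real.sq_sqrt h.le)

/-- The function is even, so it is a convex increasing function composed with the convex function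
|u|. -/
lemma ellipseEntropy_convexOn {a b : ℝ} (ha : a ≤ 1) (hb : 0 < b) (hab : b ≤ a) :
    ConvexOn ℝ (Set.Icc (-1) 1) (ellipseEntropy a b) := by
  have he : ellipseEntropy a b = ellipseEntropy a b ∘ fun u => |u| := by
    ext u
    simp [ellipseEntropy]
  have himg : (fun u : ℝ => |u|) '' Set.Icc (-1) 1 ⊆ Set.Icc 0 1 := by
    rintro _ ⟨u, hu, rfl⟩
    exact ⟨abs_nonneg u, abs_le.2 hu⟩
  have hconv : Convex ℝ ((fun u : ℝ => |u|) '' Set.Icc (-1) 1) := by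
    have : (fun u : ℝ => |u|) '' Set.Icc (-1) 1 = Set.Icc 0 1 := by
      refine himg.antisymm fun u hu => ⟨u, ⟨by linarith [hu.1], hu.2⟩, abs_of_nonneg hu.1⟩
    rw [this]
    exact convex_Icc 0 1
  rw [he]
  refine ConvexOn.comp ((ellipseEntropy_convexOn_unit ha hb hab).subset himg hconv) ?_
    ((ellipseEntropy_monotoneOn ha hb.le).mono fun u hu => (himg hu).1)
  exact convexOn_norm (E := ℝ) (convex_Icc (-1 : ℝ) 1)

lemma blochEntropy_sqrt_eq (a b u : ℝ) :
    blochEntropy √(a - b * u ^ 2) = ellipseEntropy a b u / Real.log 2 :=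
  blochEntropy_eq_binEntropy _

/-- Jensen's inequality for the entropies of points of an ellipse. -/
lemma blochEntropy_sqrt_sum_le {ι : Type*} [Fintype ι] {a b c : ℝ} (ha : a ≤ 1) (hb : 0 < b)
    (hab : b ≤ a) (p u : ι → ℝ) (hp : ∀ i, 0 ≤ p i) (hp1 : ∑ i, p i = 1)
    (hu : ∀ i, u i ∈ Set.Icc (-1) 1) (hc : ∑ i, p i * u i = c) :
    blochEntropy √(a - b * c ^ 2) ≤ ∑ i, p i * blochEntropy √(a - b * u i ^ 2) := by
  have h := (ellipseEntropy_convexOn ha hb hab).map_sum_le (t := Finset.univ) (w := p) (p := u)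
    (fun i _ => hp i) hp1 (fun i _ => hu i)
  simp only [smul_eq_mul, hc] at h
  simp only [blochEntropy_sqrt_eq, ← mul_div_assoc, ← Finset.sum_div]
  exact div_le_div_of_nonneg_right h (Real.log_pos one_lt_two).le

/-! ### Entropy from the characteristic polynomial -/

/-- Comparing root multisets avoids matching any enumeration of the eigenvalues. -/
lemma entropy_eq_sum_of_charpoly {n ι : Type*} [Fintype n] [DecidableEq n] [Fintype ι]
    {M : Matrix n n ℂ} (hM : M.IsHermitian) (f : ι → ℝ)
    (hf : M.charpoly = ∏ i, (Polynomial.X - Polynomial.C (f i : ℂ))) :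
    entropy M = ∑ i, -(f i * Real.logb 2 (f i)) := by
  have h1 := hM.roots_charpoly_eq_eigenvalues
  have h2 : (∏ i, (Polynomial.X - Polynomial.C (f i : ℂ))).roots
      = Finset.univ.val.map fun i => (f i : ℂ) := by
    rw [← Polynomial.roots_multiset_prod_X_sub_C (Finset.univ.val.map fun i => (f i : ℂ)),
      Multiset.map_map]
    rfl
  rw [hf, h2] at h1
  have h3 := congrArg (fun s => (s.map fun z : ℂ => -(z.re * Real.logb 2 z.re)).sum) h1
  simp only [Multiset.map_map, Function.comp_def, Complex.ofReal_re,
    Complex.coe_algebraMap] at h3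
  rw [entropy, dif_pos hM]
  exact h3.symm

lemma entropy_unitary_conj {n : Type*} [Fintype n] [DecidableEq n] {W : Matrix n n ℂ}
    (hW : W ∈ Matrix.unitaryGroup n ℂ) (M : Matrix n n ℂ) :
    entropy (W * M * Wᴴ) = entropy M := by
  have hW1 : Wᴴ * W = 1 := Matrix.mem_unitaryGroup_iff'.1 hW
  by_cases hM : M.IsHermitian
  · have hM' : (W * M * Wᴴ).IsHermitian := Matrix.isHermitian_mul_mul_conjTranspose W hM
    rw [entropy_eq_sum_of_charpoly hM' hM.eigenvalues, entropy, dif_pos hM]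
    rw [Matrix.charpoly_mul_comm, ← mul_assoc, hW1, one_mul, hM.charpoly_eq]
    rfl
  -- Non-Hermitian matrices get the default entropy 0; conjugating back shows that both sides fall
  -- in this case.
  · rw [entropy, entropy, dif_neg hM, dif_neg]
    intro h
    refine hM ?_
    have h' := Matrix.isHermitian_mul_mul_conjTranspose Wᴴ h
    rwa [Matrix.conjTranspose_conjTranspose, mul_assoc, mul_assoc, hW1, mul_one, ← mul_assoc,
      hW1, one_mul] at h'

lemma entropy_eq_blochEntropy {M : QMat} (hM : M.IsHermitian) (ht : M.trace = 1) {r : ℝ}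
    (hd : M.det = ((1 - r ^ 2) / 4 : ℝ)) : entropy M = blochEntropy r := by
  rw [entropy_eq_sum_of_charpoly hM ![(1 + r) / 2, (1 - r) / 2]]
  · simp only [blochEntropy, Fin.sum_univ_two, Matrix.cons_val_zero, Matrix.cons_val_one]
    ring
  · rw [Matrix.charpoly_fin_two, ht, hd, Fin.prod_univ_two]
    have h1 : (((1 - r ^ 2) / 4 : ℝ) : ℂ) = ((1 + r) / 2 : ℝ) * ((1 - r) / 2 : ℝ) := by
      push_cast; ring
    have h2 : (1 : ℂ) = ((1 + r) / 2 : ℝ) + ((1 - r) / 2 : ℝ) := by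
      push_cast; ring
    rw [h1, h2]
    simp only [Matrix.cons_val_zero, Matrix.cons_val_one, map_add, map_mul]
    ring

/-! ### Partial traces and the normal form of real X-states -/

lemma traceB_kronecker_conj (A B C D : QMat) (M : QQMat) :
    traceB ((A ⊗ₖ B) * M * (C ⊗ₖ D)) = A * traceB ((1 ⊗ₖ (D * B)) * M) * C := by
  ext i j
  simp only [traceB, Matrix.mul_apply, Fintype.sum_prod_type, Fin.sum_univ_two,
    Matrix.kroneckerMap_apply, Matrix.one_apply]
  fin_cases i <;> fin_cases j <;> simp <;> ring

lemma traceA_kronecker_conj (A B C D : QMat) (M : QQMat) :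
    traceA ((A ⊗ₖ B) * M * (C ⊗ₖ D)) = B * traceA (((C * A) ⊗ₖ 1) * M) * D := by
  ext i j
  simp only [traceA, Matrix.mul_apply, Fintype.sum_prod_type, Fin.sum_univ_two,
    Matrix.kroneckerMap_apply, Matrix.one_apply]
  fin_cases i <;> fin_cases j <;> simp <;> ring

lemma trace_eq_trace_traceB (M : QQMat) : M.trace = (traceB M).trace := by
  simp [Matrix.trace, traceB, Fintype.sum_prod_type]

/-- The real `X`-state with prescribed nonzero Mueller entries `m₀₃ = m`, `m₃₀ = n`, `m₃₃ = t`,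
`m₁₁ = x`, `m₂₂ = y`. -/
noncomputable def xState (m n t x y : ℝ) : QQMat := fun i j =>
  if i = j then (!![((1 + t + n + m) / 4 : ℂ), (1 - t + n - m) / 4;
    (1 - t - n + m) / 4, (1 + t - n - m) / 4] i.1 i.2)
  else if i.1 ≠ j.1 ∧ i.2 ≠ j.2 then (if i.1 = i.2 then ((x + y) / 4 : ℂ) else (x - y) / 4)
  else 0

lemma localConj_isDensity {U V : QMat} (hU : U ∈ Matrix.unitaryGroup (Fin 2) ℂ)
    (hV : V ∈ Matrix.unitaryGroup (Fin 2) ℂ) {ρ : QQMat} (hρ : IsDensity ρ) :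
    IsDensity (localConj U V ρ) := by
  have hW := Matrix.kronecker_mem_unitary hU hV
  refine ⟨hρ.1.mul_mul_conjTranspose_same _, ?_⟩
  rw [localConj, Matrix.trace_mul_comm, ← mul_assoc,
    show (U ⊗ₖ V)ᴴ * (U ⊗ₖ V) = 1 from Matrix.mem_unitaryGroup_iff'.1 hW, one_mul, hρ.2]

lemma IsRealX.eq_xState {τ : QQMat} (hX : IsRealX τ) (hτ : IsDensity τ) :
    τ = xState (mueller τ 0 3) (mueller τ 3 0) (mueller τ 3 3) (mueller τ 1 1)
      (mueller τ 2 2) := by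
  have hre : ∀ i, τ i i = ((τ i i).re : ℂ) := fun i =>
    (Complex.conj_eq_iff_re.1 (hτ.1.1.apply i i)).symm
  have htr : (τ (0, 0) (0, 0)).re + (τ (0, 1) (0, 1)).re
      + ((τ (1, 0) (1, 0)).re + (τ (1, 1) (1, 1)).re) = 1 := by
    have := congrArg Complex.re hτ.2
    simpa [Matrix.trace, Fintype.sum_prod_type] using this
  have hanti : ∀ i j i' j' : Fin 2, i ≠ i' → j ≠ j' →
      τ (i, j) (i', j') = ((τ (i, j) (i', j')).re : ℂ) := fun i j i' j' h h' =>
    Complex.ext rfl (by simpa using hX.2 i j i' j' h h')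
  have hs : ∀ i j, (τ i j).re = (τ j i).re := fun i j => by
    rw [← hτ.1.1.apply i j]; simp
  -- Hermiticity identifies the two halves of the anti-diagonal, leaving two parameters x ± y.
  have h1 := hs (1, 1) (0, 0)
  have h2 := hs (1, 0) (0, 1)
  have m03 : mueller τ 0 3 = (τ (0, 0) (0, 0)).re - (τ (0, 1) (0, 1)).re
      + (τ (1, 0) (1, 0)).re - (τ (1, 1) (1, 1)).re := by
    simp [mueller, Matrix.trace, Matrix.mul_apply, Fintype.sum_prod_type, pauli, pauliConj]
    ring
  have m30 : mueller τ 3 0 = (τ (0, 0) (0, 0)).re + (τ (0, 1) (0, 1)).re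
      - (τ (1, 0) (1, 0)).re - (τ (1, 1) (1, 1)).re := by
    simp [mueller, Matrix.trace, Matrix.mul_apply, Fintype.sum_prod_type, pauli, pauliConj]
    ring
  have m33 : mueller τ 3 3 = (τ (0, 0) (0, 0)).re - (τ (0, 1) (0, 1)).re
      - (τ (1, 0) (1, 0)).re + (τ (1, 1) (1, 1)).re := by
    simp [mueller, Matrix.trace, Matrix.mul_apply, Fintype.sum_prod_type, pauli, pauliConj]
    ring
  have m11 : mueller τ 1 1 = 2 * (τ (0, 0) (1, 1)).re + 2 * (τ (0, 1) (1, 0)).re := by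
    simp [mueller, Matrix.trace, Matrix.mul_apply, Fintype.sum_prod_type, pauli, pauliConj]
    linarith
  have m22 : mueller τ 2 2 = 2 * (τ (0, 0) (1, 1)).re - 2 * (τ (0, 1) (1, 0)).re := by
    simp [mueller, Matrix.trace, Matrix.mul_apply, Fintype.sum_prod_type, pauli, pauliConj]
    linarith
  rw [m03, m30, m33, m11, m22]
  have hc := congrArg (fun r : ℝ => (r : ℂ)) htr
  have h1' := congrArg (fun r : ℝ => (r : ℂ)) h1
  have h2' := congrArg (fun r : ℝ => (r : ℂ)) h2
  push_cast at hc h1' h2'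
  ext ⟨i, j⟩ ⟨i', j'⟩
  by_cases h : i = i' ↔ j = j'
  · by_cases hi : i = i'
    · obtain rfl := hi
      obtain rfl := h.1 rfl
      rw [hre]
      fin_cases i <;> fin_cases j <;> simp [xState] <;> linear_combination (1 / 4) * hc
    · have hj : j ≠ j' := fun hj => hi (h.2 hj)
      rw [hanti i j i' j' hi hj]
      fin_cases i <;> fin_cases j <;> fin_cases i' <;> fin_cases j' <;>
        simp [xState] at hi hj ⊢ <;> first | ring1 | linear_combination h1' | linear_combination h2'
  · rw [hX.1 i j i' j' h]
    fin_cases i <;> fin_cases j <;> fin_cases i' <;> fin_cases j' <;> simp [xState] at h ⊢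

/-! ### Conditional states of A after an outcome on B -/

lemma traceB_xState_mul {E : QMat} (hE : E.IsHermitian) (m n t x y : ℝ) :
    traceB ((1 ⊗ₖ E) * xState m n t x y) =
      !![(((1 + n) * (E 0 0 + E 1 1) + (m + t) * (E 0 0 - E 1 1)) / 4 : ℂ),
        ((x * (E 0 1).re : ℝ) - (y * (E 0 1).im : ℝ) * Complex.I) / 2;
        ((x * (E 0 1).re : ℝ) + (y * (E 0 1).im : ℝ) * Complex.I) / 2,
        ((1 - n) * (E 0 0 + E 1 1) + (m - t) * (E 0 0 - E 1 1)) / 4] := by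
  have h10 : E 1 0 = star (E 0 1) := (hE.apply 1 0).symm
  ext i j
  fin_cases i <;> fin_cases j <;>
    simp [traceB, Matrix.mul_apply, Fintype.sum_prod_type, xState, Matrix.one_apply]
  · ring
  · apply Complex.ext <;> simp [h10] <;> ring
  · apply Complex.ext <;> simp [h10] <;> ring
  · ring

lemma _root_.Matrix.IsHermitian.apply_self_eq_re {n : Type*} {M : Matrix n n ℂ} (hM : M.IsHermitian)
    (i : n) : M i i = ((M i i).re : ℂ) :=
  (Complex.conj_eq_iff_re.1 (hM.apply i i)).symm

lemma re_sq_add_im_sq_le {E : QMat} (hE : E.PosSemidef) :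
    (E 0 1).re ^ 2 + (E 0 1).im ^ 2 ≤ (E 0 0).re * (E 1 1).re := by
  have h := (Complex.le_def.1 hE.det_nonneg).1
  rw [Matrix.det_fin_two, ← hE.1.apply 1 0, hE.1.apply_self_eq_re 0, hE.1.apply_self_eq_re 1] at h
  simp at h
  nlinarith

lemma re_apply_self_nonneg {n : Type*} {M : Matrix n n ℂ} (hM : M.PosSemidef) (i : n) :
    0 ≤ (M i i).re :=
  (Complex.le_def.1 (hM.diag_nonneg (i := i))).1

/-- The squared length of the unnormalized Bloch vector of A after the outcome `E` on B. -/
noncomputable def outcomeBlochSq (n t x y : ℝ) (E : QMat) : ℝ :=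
  ((n * ((E 0 0).re + (E 1 1).re) + t * ((E 0 0).re - (E 1 1).re)) / 2) ^ 2
    + (x * (E 0 1).re) ^ 2 + (y * (E 0 1).im) ^ 2

section

variable (m n t x y : ℝ)

lemma outcomeProb_xState {E : QMat} (hE : E.IsHermitian) :
    outcomeProb (xState m n t x y) E
      = ((1 + m) * (E 0 0).re + (1 - m) * (E 1 1).re) / 2 := by
  rw [outcomeProb, trace_eq_trace_traceB, traceB_xState_mul hE, Matrix.trace_fin_two]
  simp
  ring

lemma trace_traceB_xState_mul {E : QMat} (hE : E.IsHermitian) :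
    (traceB ((1 ⊗ₖ E) * xState m n t x y)).trace = outcomeProb (xState m n t x y) E := by
  rw [outcomeProb_xState m n t x y hE, traceB_xState_mul hE, Matrix.trace_fin_two]
  simp only [Matrix.of_apply, Matrix.cons_val', Matrix.cons_val_zero, Matrix.cons_val_one,
    Matrix.cons_val_fin_one]
  rw [hE.apply_self_eq_re 0, hE.apply_self_eq_re 1]
  simp only [Complex.ofReal_re]
  push_cast
  ring

lemma det_traceB_xState_mul {E : QMat} (hE : E.IsHermitian) :
    (traceB ((1 ⊗ₖ E) * xState m n t x y)).det =
      (((outcomeProb (xState m n t x y) E ^ 2 - outcomeBlochSq n t x y E) / 4 : ℝ) : ℂ) := by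
  rw [outcomeProb_xState m n t x y hE, traceB_xState_mul hE, Matrix.det_fin_two, outcomeBlochSq]
  simp only [Matrix.of_apply, Matrix.cons_val', Matrix.cons_val_zero, Matrix.cons_val_one,
    Matrix.cons_val_fin_one]
  rw [hE.apply_self_eq_re 0, hE.apply_self_eq_re 1]
  simp only [Complex.ofReal_re]
  push_cast
  ring_nf
  rw [Complex.I_sq]
  ring

lemma traceB_xState_mul_isHermitian {E : QMat} (hE : E.IsHermitian) :
    (traceB ((1 ⊗ₖ E) * xState m n t x y)).IsHermitian := by
  rw [traceB_xState_mul hE, hE.apply_self_eq_re 0, hE.apply_self_eq_re 1]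
  ext i j
  fin_cases i <;> fin_cases j <;> simp [Matrix.conjTranspose_apply, Complex.conj_ofReal]
  ring

lemma condState_xState_isHermitian {E : QMat} (hE : E.IsHermitian) :
    (condState (xState m n t x y) E).IsHermitian := by
  refine (traceB_xState_mul_isHermitian m n t x y hE).smul ?_
  simp [IsSelfAdjoint]

lemma entropy_condState_xState {E : QMat} (hE : E.IsHermitian)
    (hp : outcomeProb (xState m n t x y) E ≠ 0) :
    entropy (condState (xState m n t x y) E)
      = blochEntropy (√(outcomeBlochSq n t x y E) / outcomeProb (xState m n t x y) E) := by
  have hp' : (outcomeProb (xState m n t x y) E : ℂ) ≠ 0 := by exact_mod_cast hp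
  refine entropy_eq_blochEntropy (condState_xState_isHermitian m n t x y hE) ?_ ?_
  · rw [condState, Matrix.trace_smul, trace_traceB_xState_mul m n t x y hE, smul_eq_mul]
    push_cast
    exact inv_mul_cancel₀ hp'
  · have hR : 0 ≤ outcomeBlochSq n t x y E := by unfold outcomeBlochSq; positivity
    rw [condState, Matrix.det_smul, det_traceB_xState_mul m n t x y hE, div_pow, Real.sq_sqrt hR]
    simp only [Fintype.card_fin]
    push_cast
    field_simp

/-! ### The projections along z and x -/

lemma axisProjection_one_three :
    axisProjection 1 3 = ![!![1, 0; 0, 0], !![0, 0; 0, 1]] := by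
  ext k i j
  fin_cases k <;> fin_cases i <;> fin_cases j <;>
    simp [axisProjection, pauliConj, pauli] <;> norm_num

lemma axisProjection_one_one :
    axisProjection 1 1 = ![!![1 / 2, 1 / 2; 1 / 2, 1 / 2], !![1 / 2, -1 / 2; -1 / 2, 1 / 2]] := by
  ext k i j
  fin_cases k <;> fin_cases i <;> fin_cases j <;>
    simp [axisProjection, pauliConj, pauli] <;> norm_num

lemma posSemidef_of_projection {M : QMat} (h : M.IsHermitian) (h2 : M * M = M) :
    M.PosSemidef := by
  have := Matrix.posSemidef_conjTranspose_mul_self M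
  rwa [h.eq, h2] at this

lemma isPOVM_axisProjection_one_three : IsPOVM (axisProjection 1 3) := by
  rw [axisProjection_one_three]
  constructor
  · intro k
    fin_cases k <;> refine posSemidef_of_projection ?_ ?_ <;> ext i j <;>
      fin_cases i <;> fin_cases j <;> simp
  · ext i j
    fin_cases i <;> fin_cases j <;> simp [Fin.sum_univ_two]

lemma isPOVM_axisProjection_one_one : IsPOVM (axisProjection 1 1) := by
  rw [axisProjection_one_one]
  constructor
  · intro k
    fin_cases k <;> refine posSemidef_of_projection ?_ ?_ <;> ext i j <;>
      fin_cases i <;> fin_cases j <;> simp <;> norm_num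
  · ext i j
    fin_cases i <;> fin_cases j <;> simp [Fin.sum_univ_two] <;> norm_num

/-- Both outcomes have probability 1/2 and conditional Bloch vectors (±x, 0, n), of equal length. -/
lemma condEntropy_xState_axis_one :
    condEntropy (xState m n t x y) (axisProjection 1 1) = blochEntropy √(x ^ 2 + n ^ 2) := by
  have hE := fun k => (isPOVM_axisProjection_one_one.1 k).1
  have hp : ∀ k, outcomeProb (xState m n t x y) (axisProjection 1 1 k) = 1 / 2 := by
    intro k
    rw [outcomeProb_xState m n t x y (hE k), axisProjection_one_one]
    fin_cases k <;> simp <;> ring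
  have hR : ∀ k, √(outcomeBlochSq n t x y (axisProjection 1 1 k)) = √(x ^ 2 + n ^ 2) / 2 := by
    intro k
    have h : outcomeBlochSq n t x y (axisProjection 1 1 k) = (x ^ 2 + n ^ 2) / 2 ^ 2 := by
      rw [outcomeBlochSq, axisProjection_one_one]
      fin_cases k <;> simp <;> ring
    rw [h, Real.sqrt_div' _ (by positivity), Real.sqrt_sq (by positivity)]
  have he : ∀ k, entropy (condState (xState m n t x y) (axisProjection 1 1 k))
      = blochEntropy √(x ^ 2 + n ^ 2) := by
    intro k
    rw [entropy_condState_xState m n t x y (hE k) (by rw [hp]; norm_num), hp, hR]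
    congr 1
    ring
  simp only [condEntropy, hp, he, Fin.sum_univ_two]
  ring

/-- Centring places the two conditional Bloch vectors at ±t on the z-axis, so the unequal weights (1
± m)/2 do not matter. -/
lemma condEntropy_xState_axis_three (hm : |m| < 1) :
    condEntropy (xState m (m * t) t x y) (axisProjection 1 3) = blochEntropy |t| := by
  obtain ⟨h1, h2⟩ := abs_lt.1 hm
  have hE := fun k => (isPOVM_axisProjection_one_three.1 k).1
  have hp0 : outcomeProb (xState m (m * t) t x y) (axisProjection 1 3 0) = (1 + m) / 2 := by
    rw [outcomeProb_xState _ _ _ _ _ (hE 0), axisProjection_one_three]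
    simp
  have hp1 : outcomeProb (xState m (m * t) t x y) (axisProjection 1 3 1) = (1 - m) / 2 := by
    rw [outcomeProb_xState _ _ _ _ _ (hE 1), axisProjection_one_three]
    simp
  have hR0 : √(outcomeBlochSq (m * t) t x y (axisProjection 1 3 0)) = |t| * ((1 + m) / 2) := by
    have h : outcomeBlochSq (m * t) t x y (axisProjection 1 3 0) = (t * ((1 + m) / 2)) ^ 2 := by
      rw [outcomeBlochSq, axisProjection_one_three]
      simp
      ring
    rw [h, Real.sqrt_sq_eq_abs, abs_mul, abs_of_pos (by linarith : 0 < (1 + m) / 2)]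
  have hR1 : √(outcomeBlochSq (m * t) t x y (axisProjection 1 3 1)) = |t| * ((1 - m) / 2) := by
    have h : outcomeBlochSq (m * t) t x y (axisProjection 1 3 1) = (t * ((1 - m) / 2)) ^ 2 := by
      rw [outcomeBlochSq, axisProjection_one_three]
      simp
      ring
    rw [h, Real.sqrt_sq_eq_abs, abs_mul, abs_of_pos (by linarith : 0 < (1 - m) / 2)]
  rw [condEntropy, Fin.sum_univ_two,
    entropy_condState_xState _ _ _ _ _ (hE 0) (by rw [hp0]; linarith),
    entropy_condState_xState _ _ _ _ _ (hE 1) (by rw [hp1]; linarith), hp0, hp1, hR0, hR1,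
    mul_div_cancel_right₀ _ (by linarith), mul_div_cancel_right₀ _ (by linarith)]
  ring

end

/-! ### Lower bounds over all POVMs -/

variable {m t x y : ℝ}

/-- Centring makes the diagonal factor as (1 ± t)(1 ± m)/4. Positivity of the two blocks then gives
|x ± y| ≤ (1 ± t)√(1 - m²), and adding the two bounds eliminates y and t. -/
lemma xState_bounds (h : IsDensity (xState m (m * t) t x y)) (hm : |m| < 1) :
    |t| ≤ 1 ∧ x ^ 2 ≤ 1 - m ^ 2 := by
  obtain ⟨h1, h2⟩ := abs_lt.1 hm
  have d00 := re_apply_self_nonneg h.1 (0, 0)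
  have d01 := re_apply_self_nonneg h.1 (0, 1)
  have e1 := re_sq_add_im_sq_le (h.1.submatrix ![(0, 0), (1, 1)])
  have e2 := re_sq_add_im_sq_le (h.1.submatrix ![(0, 1), (1, 0)])
  simp [xState] at d00 d01 e1 e2
  have ht1 : 0 ≤ 1 + t := by
    have : 0 ≤ (1 + m) * (1 + t) := by linarith
    exact nonneg_of_mul_nonneg_right this (by linarith)
  have ht2 : 0 ≤ 1 - t := by
    have : 0 ≤ (1 - m) * (1 - t) := by linarith
    exact nonneg_of_mul_nonneg_right this (by linarith)
  have hm2 : 0 ≤ 1 - m ^ 2 := by nlinarith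
  refine ⟨abs_le.2 ⟨by linarith, by linarith⟩, ?_⟩
  have hs := Real.sq_sqrt hm2
  have hs0 := Real.sqrt_nonneg (1 - m ^ 2)
  set s := √(1 - m ^ 2)
  have f1 : |x + y| ≤ (1 + t) * s := by
    refine abs_le_of_sq_le_sq ?_ (by positivity)
    rw [mul_pow, hs]
    nlinarith
  have f2 : |x - y| ≤ (1 - t) * s := by
    refine abs_le_of_sq_le_sq ?_ (by positivity)
    rw [mul_pow, hs]
    nlinarith
  rw [← hs]
  rw [abs_le] at f1 f2
  exact sq_le_sq' (by linarith) (by linarith)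

lemma outcomeBlochSq_le (hxy : y ^ 2 ≤ x ^ 2) {E : QMat} (hE : E.PosSemidef) :
    outcomeBlochSq (m * t) t x y E
      ≤ t ^ 2 * (((1 + m) * (E 0 0).re - (1 - m) * (E 1 1).re) / 2) ^ 2
        + x ^ 2 * ((E 0 0).re * (E 1 1).re) := by
  have h1 := mul_le_mul_of_nonneg_left (re_sq_add_im_sq_le hE) (sq_nonneg x)
  have h2 := mul_le_mul_of_nonneg_right hxy (sq_nonneg (E 0 1).im)
  unfold outcomeBlochSq
  nlinarith

lemma outcomeProb_xState_nonneg (n : ℝ) (hm : |m| < 1) {E : QMat} (hE : E.PosSemidef) :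
    0 ≤ outcomeProb (xState m n t x y) E := by
  obtain ⟨h1, h2⟩ := abs_lt.1 hm
  rw [outcomeProb_xState _ _ _ _ _ hE.1]
  have := mul_nonneg (by linarith : 0 ≤ 1 + m) (re_apply_self_nonneg hE 0)
  have := mul_nonneg (by linarith : 0 ≤ 1 - m) (re_apply_self_nonneg hE 1)
  linarith

lemma IsPOVM.sum_re_apply_self {k : ℕ} {E : Fin k → QMat} (hE : IsPOVM E) (i : Fin 2) :
    ∑ j, (E j i i).re = 1 := by
  have h := congrArg (fun M : QMat => (M i i).re) hE.2
  simpa [Matrix.sum_apply] using h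

lemma IsPOVM.sum_outcomeProb_xState {k : ℕ} {E : Fin k → QMat} (hE : IsPOVM E) (n : ℝ) :
    ∑ j, outcomeProb (xState m n t x y) (E j) = 1 := by
  simp only [outcomeProb_xState _ _ _ _ _ (hE.1 _).1, ← Finset.sum_div, Finset.sum_add_distrib,
    ← Finset.mul_sum, hE.sum_re_apply_self]
  ring

/-- If the longest semi-axis is along `z`, every measurement leaves at least `S₂(|t|)`. -/
lemma blochEntropy_abs_le_condEntropy (hm : |m| < 1) (ht : |t| ≤ 1) (hxy : y ^ 2 ≤ x ^ 2)
    (hxt : x ^ 2 ≤ t ^ 2 * (1 - m ^ 2)) {k : ℕ} {E : Fin k → QMat} (hE : IsPOVM E) :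
    blochEntropy |t| ≤ condEntropy (xState m (m * t) t x y) E := by
  rw [← one_mul (blochEntropy |t|),
    ← hE.sum_outcomeProb_xState (m := m) (t := t) (x := x) (y := y) (m * t), Finset.sum_mul]
  refine Finset.sum_le_sum fun j _ => ?_
  have hp := outcomeProb_xState_nonneg (t := t) (x := x) (y := y) (m * t) hm (hE.1 j)
  rcases hp.eq_or_lt with hp | hp
  · rw [← hp]; simp
  refine mul_le_mul_of_nonneg_left ?_ hp.le
  rw [entropy_condState_xState _ _ _ _ _ (hE.1 j).1 hp.ne']
  have hr : √(outcomeBlochSq (m * t) t x y (E j)) / outcomeProb (xState m (m * t) t x y) (E j)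
      ≤ |t| := by
    rw [div_le_iff₀ hp]
    refine Real.sqrt_le_iff.2 ⟨by positivity, (outcomeBlochSq_le hxy (hE.1 j)).trans ?_⟩
    rw [mul_pow, sq_abs, outcomeProb_xState _ _ _ _ _ (hE.1 j).1]
    have := mul_le_mul_of_nonneg_right hxt
      (mul_nonneg (re_apply_self_nonneg (hE.1 j) 0) (re_apply_self_nonneg (hE.1 j) 1))
    -- With p² - q² = (1 - m²)e₀e₁, the bound t²q² + x²e₀e₁ is at most t²p².
    nlinarith
  exact blochEntropy_strictAntiOn.antitoneOn ⟨by positivity, hr.trans ht⟩ ⟨abs_nonneg t, ht⟩ hr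

/-- If the longest semi-axis is along `x`, Jensen's inequality bounds every measurement. -/
lemma blochEntropy_sqrt_le_condEntropy (hm : |m| < 1) (hx : x ^ 2 ≤ 1 - m ^ 2)
    (hxy : y ^ 2 ≤ x ^ 2) (hxt : t ^ 2 * (1 - m ^ 2) < x ^ 2) {k : ℕ} {E : Fin k → QMat}
    (hE : IsPOVM E) :
    blochEntropy √(x ^ 2 + (m * t) ^ 2) ≤ condEntropy (xState m (m * t) t x y) E := by
  have hm2 : 0 < 1 - m ^ 2 := by
    have := (sq_lt_one_iff_abs_lt_one m).2 hm
    linarith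
  obtain ⟨h1, h2⟩ := abs_lt.1 hm
  set a := x ^ 2 / (1 - m ^ 2) with ha
  have hax : a * (1 - m ^ 2) = x ^ 2 := div_mul_cancel₀ _ hm2.ne'
  have ha1 : a ≤ 1 := (div_le_one hm2).2 hx
  have hat : t ^ 2 < a := (lt_div_iff₀ hm2).2 hxt
  set p := fun j => outcomeProb (xState m (m * t) t x y) (E j) with hpdef
  set q := fun j => ((1 + m) * (E j 0 0).re - (1 - m) * (E j 1 1).re) / 2 with hqdef
  have hp0 : ∀ j, 0 ≤ p j := fun j => outcomeProb_xState_nonneg _ hm (hE.1 j)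
  have hpE : ∀ j, p j = ((1 + m) * (E j 0 0).re + (1 - m) * (E j 1 1).re) / 2 := fun j =>
    outcomeProb_xState _ _ _ _ _ (hE.1 j).1
  have hqp : ∀ j, |q j| ≤ p j := by
    intro j
    rw [hpE, abs_le]
    have := mul_nonneg (by linarith : 0 ≤ 1 + m) (re_apply_self_nonneg (hE.1 j) 0)
    have := mul_nonneg (by linarith : 0 ≤ 1 - m) (re_apply_self_nonneg (hE.1 j) 1)
    constructor <;> simp only [hqdef] <;> linarith
  -- When p = 0, |q| ≤ p forces q = 0, so the value 0 of the quotient is harmless.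
  have hpq : ∀ j, p j * (q j / p j) = q j := by
    intro j
    rcases (hp0 j).eq_or_lt with h | h
    · have := hqp j
      rw [← h] at this ⊢
      rw [abs_nonpos_iff.1 this]
      simp
    · exact mul_div_cancel₀ _ h.ne'
  have hq1 : ∑ j, q j = m := by
    simp only [hqdef, ← Finset.sum_div, Finset.sum_sub_distrib, ← Finset.mul_sum,
      hE.sum_re_apply_self]
    ring
  have hJ := blochEntropy_sqrt_sum_le (c := m) ha1 (sub_pos.2 hat)
    (by nlinarith [sq_nonneg t] : a - t ^ 2 ≤ a) p (fun j => q j / p j) hp0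
    (hE.sum_outcomeProb_xState _)
    (fun j => abs_le.1 (by
      rw [abs_div, abs_of_nonneg (hp0 j)]; exact div_le_one_of_le₀ (hqp j) (hp0 j)))
    (by simp only [hpq, hq1])
  -- The radius at the mean u = m is the one produced by the projection along x.
  rw [show a - (a - t ^ 2) * m ^ 2 = x ^ 2 + (m * t) ^ 2 by rw [← hax]; ring] at hJ
  refine hJ.trans (Finset.sum_le_sum fun j _ => ?_)
  rcases (hp0 j).eq_or_lt with h | h
  · change p j * _ ≤ p j * _
    rw [← h]; simp
  refine mul_le_mul_of_nonneg_left ?_ h.le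
  rw [entropy_condState_xState _ _ _ _ _ (hE.1 j).1 h.ne']
  have hle : √(outcomeBlochSq (m * t) t x y (E j)) / p j
      ≤ √(a - (a - t ^ 2) * (q j / p j) ^ 2) := by
    rw [div_le_iff₀ h]
    rw [← Real.sqrt_sq h.le, ← Real.sqrt_mul' _ (sq_nonneg _), Real.sqrt_sq h.le]
    refine Real.sqrt_le_sqrt ((outcomeBlochSq_le hxy (hE.1 j)).trans_eq ?_)
    have : (a - (a - t ^ 2) * (q j / p j) ^ 2) * p j ^ 2 = a * p j ^ 2 - (a - t ^ 2) * q j ^ 2 := by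
      field_simp
    rw [this, hpE, ← hax]
    simp only [hqdef]
    ring
  have hle1 : √(a - (a - t ^ 2) * (q j / p j) ^ 2) ≤ 1 :=
    Real.sqrt_le_one.2 (by nlinarith [mul_nonneg (sub_pos.2 hat).le (sq_nonneg (q j / p j))])
  exact blochEntropy_strictAntiOn.antitoneOn ⟨by positivity, hle.trans hle1⟩
    ⟨Real.sqrt_nonneg _, hle1⟩ hle

/-! ### Spectrum of an X-state and of its B-marginal -/

lemma charpoly_eq_prod_of_trace_det {M : QMat} {p q : ℝ} (ht : M.trace = ((p + q : ℝ) : ℂ))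
    (hd : M.det = ((p * q : ℝ) : ℂ)) :
    M.charpoly = (Polynomial.X - Polynomial.C (p : ℂ)) * (Polynomial.X - Polynomial.C (q : ℂ)) := by
  rw [Matrix.charpoly_fin_two, ht, hd]
  simp only [Complex.ofReal_add, Complex.ofReal_mul, map_add, map_mul]
  ring

/-- The splitting of the computational basis into the diagonal `|jj⟩` and the off-diagonal pair. -/
def parityEquiv : Fin 2 × Fin 2 ≃ Fin 2 ⊕ Fin 2 where
  toFun p := if p.1 = p.2 then .inl p.1 else .inr p.1
  invFun := Sum.elim (fun i => (i, i)) (fun i => (i, i + 1))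
  left_inv := by decide
  right_inv := by decide

lemma reindex_xState (m n t x y : ℝ) :
    Matrix.reindex parityEquiv parityEquiv (xState m n t x y) =
      Matrix.fromBlocks
        !![((1 + t + n + m) / 4 : ℂ), (x + y) / 4; (x + y) / 4, (1 + t - n - m) / 4] 0 0
        !![((1 - t + n - m) / 4 : ℂ), (x - y) / 4; (x - y) / 4, (1 - t - n + m) / 4] := by
  ext i j
  rcases i with i | i <;> rcases j with j | j <;> fin_cases i <;> fin_cases j <;>
    simp [parityEquiv, xState]

/-- The closed form of the spectrum of a real `X`-state. -/
noncomputable def xSpectrum (m n t x y : ℝ) : Fin 4 → ℝ :=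
  ![(1 + t) / 4 + √((x + y) ^ 2 + (n + m) ^ 2) / 4, (1 - t) / 4 + √((x - y) ^ 2 + (n - m) ^ 2) / 4,
    (1 - t) / 4 - √((x - y) ^ 2 + (n - m) ^ 2) / 4, (1 + t) / 4 - √((x + y) ^ 2 + (n + m) ^ 2) / 4]

lemma charpoly_xState (m n t x y : ℝ) :
    (xState m n t x y).charpoly
      = ∏ i, (Polynomial.X - Polynomial.C (xSpectrum m n t x y i : ℂ)) := by
  have h1 := Real.sq_sqrt (by positivity : 0 ≤ (x + y) ^ 2 + (n + m) ^ 2)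
  have h2 := Real.sq_sqrt (by positivity : 0 ≤ (x - y) ^ 2 + (n - m) ^ 2)
  rw [← Matrix.charpoly_reindex parityEquiv, reindex_xState, Matrix.charpoly_fromBlocks_zero₁₂,
    Fin.prod_univ_four]
  simp only [xSpectrum, Matrix.cons_val]
  rw [charpoly_eq_prod_of_trace_det (p := (1 + t) / 4 + √((x + y) ^ 2 + (n + m) ^ 2) / 4)
      (q := (1 + t) / 4 - √((x + y) ^ 2 + (n + m) ^ 2) / 4),
    charpoly_eq_prod_of_trace_det (p := (1 - t) / 4 + √((x - y) ^ 2 + (n - m) ^ 2) / 4)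
      (q := (1 - t) / 4 - √((x - y) ^ 2 + (n - m) ^ 2) / 4)]
  · ring
  · simp [Matrix.trace_fin_two]; ring
  · have : (((1 - t) / 4 + √((x - y) ^ 2 + (n - m) ^ 2) / 4)
        * ((1 - t) / 4 - √((x - y) ^ 2 + (n - m) ^ 2) / 4))
        = ((1 - t) ^ 2 - ((x - y) ^ 2 + (n - m) ^ 2)) / 16 := by rw [← h2]; simp; ring
    rw [this, Matrix.det_fin_two]
    simp
    ring
  · simp [Matrix.trace_fin_two]; ring
  · have : (((1 + t) / 4 + √((x + y) ^ 2 + (n + m) ^ 2) / 4)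
        * ((1 + t) / 4 - √((x + y) ^ 2 + (n + m) ^ 2) / 4))
        = ((1 + t) ^ 2 - ((x + y) ^ 2 + (n + m) ^ 2)) / 16 := by rw [← h1]; simp; ring
    rw [this, Matrix.det_fin_two]
    simp
    ring

lemma traceA_xState (m n t x y : ℝ) :
    traceA (xState m n t x y) = !![((1 + m) / 2 : ℂ), 0; 0, (1 - m) / 2] := by
  ext i j
  fin_cases i <;> fin_cases j <;> simp [traceA, xState] <;> ring

lemma entropy_traceA_xState (m n t x y : ℝ) :
    entropy (traceA (xState m n t x y)) = blochEntropy m := by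
  rw [traceA_xState]
  refine entropy_eq_blochEntropy ?_ ?_ ?_
  · ext i j
    fin_cases i <;> fin_cases j <;> simp [Matrix.conjTranspose_apply, Complex.conj_ofReal]
  · rw [Matrix.trace_fin_two]
    simp
    ring
  · rw [Matrix.det_fin_two]
    simp
    ring

/-! ### Local unitary covariance and the discord -/

lemma entropy_localConj {U V : QMat} (hU : U ∈ Matrix.unitaryGroup (Fin 2) ℂ)
    (hV : V ∈ Matrix.unitaryGroup (Fin 2) ℂ) (ρ : QQMat) :
    entropy (localConj U V ρ) = entropy ρ :=
  entropy_unitary_conj (Matrix.kronecker_mem_unitary hU hV) ρ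

lemma entropy_traceA_localConj {U V : QMat} (hU : U ∈ Matrix.unitaryGroup (Fin 2) ℂ)
    (hV : V ∈ Matrix.unitaryGroup (Fin 2) ℂ) (ρ : QQMat) :
    entropy (traceA (localConj U V ρ)) = entropy (traceA ρ) := by
  rw [localConj, Matrix.conjTranspose_kronecker, traceA_kronecker_conj,
    show Uᴴ * U = 1 from Matrix.mem_unitaryGroup_iff'.1 hU, Matrix.one_kronecker_one, one_mul,
    entropy_unitary_conj hV]

lemma traceB_mul_localConj (U V E : QMat) (ρ : QQMat) :
    traceB ((1 ⊗ₖ E) * localConj U V ρ) = U * traceB ((1 ⊗ₖ (Vᴴ * E * V)) * ρ) * Uᴴ := by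
  rw [localConj, Matrix.conjTranspose_kronecker, ← mul_assoc, ← mul_assoc,
    ← Matrix.mul_kronecker_mul, one_mul, traceB_kronecker_conj, mul_assoc Vᴴ]

lemma outcomeProb_localConj {U : QMat} (hU : U ∈ Matrix.unitaryGroup (Fin 2) ℂ) (V E : QMat)
    (ρ : QQMat) : outcomeProb (localConj U V ρ) E = outcomeProb ρ (Vᴴ * E * V) := by
  rw [outcomeProb, outcomeProb, trace_eq_trace_traceB, trace_eq_trace_traceB (_ * ρ),
    traceB_mul_localConj, Matrix.trace_mul_comm, ← mul_assoc,
    show Uᴴ * U = 1 from Matrix.mem_unitaryGroup_iff'.1 hU, one_mul]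

lemma condEntropy_localConj {U : QMat} (hU : U ∈ Matrix.unitaryGroup (Fin 2) ℂ) (V : QMat)
    (ρ : QQMat) {k : ℕ} (E : Fin k → QMat) :
    condEntropy (localConj U V ρ) E = condEntropy ρ fun j => Vᴴ * E j * V := by
  refine Finset.sum_congr rfl fun j _ => ?_
  rw [outcomeProb_localConj hU]
  congr 1
  rw [condState, condState, outcomeProb_localConj hU, traceB_mul_localConj,
    ← entropy_unitary_conj hU (_ • traceB ((1 ⊗ₖ (Vᴴ * E j * V)) * ρ)), Matrix.mul_smul,
    Matrix.smul_mul]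

lemma IsPOVM.unitary_conj {k : ℕ} {E : Fin k → QMat} (hE : IsPOVM E) {W : QMat}
    (hW : W ∈ Matrix.unitaryGroup (Fin 2) ℂ) : IsPOVM fun j => W * E j * Wᴴ := by
  refine ⟨fun j => (hE.1 j).mul_mul_conjTranspose_same W, ?_⟩
  rw [← Finset.sum_mul, ← Finset.mul_sum, hE.2, mul_one]
  exact Matrix.mem_unitaryGroup_iff.1 hW

lemma axisProjection_eq_conj (V : QMat) (a : Fin 4) :
    axisProjection V a = fun j => Vᴴ * axisProjection 1 a j * V := by
  ext1 j
  fin_cases j <;> simp [axisProjection, -smul_add]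

lemma classicalCorrelation_eq {ρ : QQMat} {s : ℝ} (h : IsLeast (condEntropyValues ρ) s) :
    classicalCorrelation ρ = entropy (traceB ρ) - s := by
  refine IsGreatest.csSup_eq ⟨?_, ?_⟩
  · obtain ⟨k, E, hE, hs⟩ := h.1
    exact ⟨k, E, hE, by rw [hs]⟩
  · rintro _ ⟨k, E, hE, rfl⟩
    exact sub_le_sub_left (h.2 ⟨k, E, hE, rfl⟩) _

lemma mueller_zero_three_xState (m n t x y : ℝ) : mueller (xState m n t x y) 0 3 = m := by
  simp [mueller, Matrix.trace, Matrix.mul_apply, Fintype.sum_prod_type, pauli, pauliConj, xState]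
  ring

/-- A measurement whose average conditional entropy bounds that of every other measurement
determines the discord. -/
lemma optimal_of_forall_le {ρ τ : QQMat} {U V : QMat}
    (hU : U ∈ Matrix.unitaryGroup (Fin 2) ℂ) (hV : V ∈ Matrix.unitaryGroup (Fin 2) ℂ)
    (hτ : τ = localConj U V ρ) (hX : IsRealX τ) (hd : IsDensity τ) {a : Fin 4} {s : ℝ}
    (ha : IsPOVM (axisProjection 1 a)) (hs : condEntropy τ (axisProjection 1 a) = s)
    (hle : ∀ (k : ℕ) (E : Fin k → QMat), IsPOVM E → s ≤ condEntropy τ E) :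
    IsOptimalPOVM ρ (axisProjection V a) ∧ IsLeast (condEntropyValues ρ) s ∧
      discord ρ = entropyGapX τ + s := by
  have hV' : Vᴴ ∈ Matrix.unitaryGroup (Fin 2) ℂ := Unitary.star_mem hV
  have hVV : Vᴴ * V = 1 := Matrix.mem_unitaryGroup_iff'.1 hV
  have hP : IsPOVM (axisProjection V a) := by
    rw [axisProjection_eq_conj]
    simpa using ha.unitary_conj hV'
  have hval : condEntropy ρ (axisProjection V a) = s := by
    rw [axisProjection_eq_conj, ← condEntropy_localConj hU, ← hτ, hs]
  -- Measuring E on ρ amounts to measuring V E V† on τ.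
  have hlow : ∀ (k : ℕ) (E : Fin k → QMat), IsPOVM E → s ≤ condEntropy ρ E := by
    intro k E hE
    refine (hle k _ (hE.unitary_conj hV)).trans_eq ?_
    rw [hτ, condEntropy_localConj hU]
    congr 1
    ext1 j
    rw [mul_assoc, mul_assoc, mul_assoc, hVV, mul_one, ← mul_assoc, hVV, one_mul]
  have hleast : IsLeast (condEntropyValues ρ) s :=
    ⟨⟨2, _, hP, hval.symm⟩, by rintro _ ⟨k, E, hE, rfl⟩; exact hlow k E hE⟩
  refine ⟨⟨hP, fun l F hF => hval.trans_le (hlow l F hF)⟩, hleast, ?_⟩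
  have hA : entropy (traceA ρ) = blochEntropy |mueller τ 0 3| := by
    rw [blochEntropy_abs, ← entropy_traceA_localConj hU hV, ← hτ, hX.eq_xState hd,
      entropy_traceA_xState, mueller_zero_three_xState]
  have hS : entropy ρ = -∑ i, spectrumX τ i * Real.logb 2 (spectrumX τ i) := by
    rw [← entropy_localConj hU hV, ← hτ,
      entropy_eq_sum_of_charpoly hd.1.1 (spectrumX τ), Finset.sum_neg_distrib]
    -- Only the characteristic polynomial is rewritten; the eigenvalues on the right must keep the
    -- Mueller entries of τ.
    conv_lhs => rw [hX.eq_xState hd]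
    exact charpoly_xState _ _ _ _ _
  rw [discord, mutualInformation, classicalCorrelation_eq hleast, entropyGapX, hA, hS]
  ring

end TwoQubit

open TwoQubit

theorem mainTheorem6
    (ρ τ : TwoQubit.QQMat) (hρ : TwoQubit.IsDensity ρ)
    (U V : TwoQubit.QMat)
    (hU : U ∈ Matrix.unitaryGroup (Fin 2) ℂ) (hV : V ∈ Matrix.unitaryGroup (Fin 2) ℂ)
    (hτ : τ = TwoQubit.localConj U V ρ)
    (hX : TwoQubit.IsRealX τ)
    (hB : |TwoQubit.mueller τ 0 3| < 1)
    (hxy : TwoQubit.semiaxisY τ ≤ TwoQubit.semiaxisX τ)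
    (hc : TwoQubit.centerZ τ = 0) :
    (TwoQubit.semiaxisX τ < TwoQubit.semiaxisZ τ →
      TwoQubit.IsOptimalPOVM ρ (TwoQubit.axisProjection V 3) ∧
      TwoQubit.condEntropy ρ (TwoQubit.axisProjection V 3)
        < TwoQubit.condEntropy ρ (TwoQubit.axisProjection V 1) ∧
      IsLeast (TwoQubit.condEntropyValues ρ)
        (TwoQubit.blochEntropy (TwoQubit.semiaxisZ τ)) ∧
      TwoQubit.discord ρ
        = TwoQubit.entropyGapX τ + TwoQubit.blochEntropy (TwoQubit.semiaxisZ τ)) ∧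
    (TwoQubit.semiaxisZ τ < TwoQubit.semiaxisX τ →
      TwoQubit.IsOptimalPOVM ρ (TwoQubit.axisProjection V 1) ∧
      TwoQubit.condEntropy ρ (TwoQubit.axisProjection V 1)
        < TwoQubit.condEntropy ρ (TwoQubit.axisProjection V 3) ∧
      IsLeast (TwoQubit.condEntropyValues ρ)
        (TwoQubit.blochEntropy √(TwoQubit.mueller τ 1 1 ^ 2 + TwoQubit.mueller τ 3 0 ^ 2)) ∧
      TwoQubit.discord ρ
        = TwoQubit.entropyGapX τ
          + TwoQubit.blochEntropy √(TwoQubit.mueller τ 1 1 ^ 2 + TwoQubit.mueller τ 3 0 ^ 2)) := by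
  have hd : IsDensity τ := hτ ▸ localConj_isDensity hU hV hρ
  have heq := hX.eq_xState hd
  have hm2 : 0 < 1 - mueller τ 0 3 ^ 2 := by
    have := (sq_lt_one_iff_abs_lt_one (mueller τ 0 3)).2 hB
    linarith
  have hsq := Real.sqrt_pos.2 hm2
  have hn : mueller τ 3 0 = mueller τ 0 3 * mueller τ 3 3 := by
    rcases div_eq_zero_iff.1 hc with h | h
    · linarith
    · exact absurd h hm2.ne'
  have hz : semiaxisZ τ = |mueller τ 3 3| := by
    rw [semiaxisZ, hn, show mueller τ 3 3 - mueller τ 0 3 * (mueller τ 0 3 * mueller τ 3 3)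
      = mueller τ 3 3 * (1 - mueller τ 0 3 ^ 2) by ring, abs_mul, abs_of_pos hm2,
      mul_div_cancel_right₀ _ hm2.ne']
  have hx : semiaxisX τ ^ 2 * (1 - mueller τ 0 3 ^ 2) = mueller τ 1 1 ^ 2 := by
    rw [semiaxisX, div_pow, sq_abs, Real.sq_sqrt hm2.le, div_mul_cancel₀ _ hm2.ne']
  have hx0 : 0 ≤ semiaxisX τ := div_nonneg (abs_nonneg _) hsq.le
  have hyx : mueller τ 2 2 ^ 2 ≤ mueller τ 1 1 ^ 2 :=
    sq_le_sq.2 ((div_le_div_iff_of_pos_right hsq).1 hxy)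
  rw [hz]
  rw [hn] at heq ⊢
  obtain ⟨ht, hx1⟩ := xState_bounds (heq ▸ hd) hB
  have hval1 := condEntropy_xState_axis_one (mueller τ 0 3) (mueller τ 0 3 * mueller τ 3 3)
    (mueller τ 3 3) (mueller τ 1 1) (mueller τ 2 2)
  have hval3 := condEntropy_xState_axis_three (mueller τ 0 3) (mueller τ 3 3) (mueller τ 1 1)
    (mueller τ 2 2) hB
  have hlow3 := fun h (k : ℕ) (E : Fin k → QMat) (hE : IsPOVM E) =>
    blochEntropy_abs_le_condEntropy hB ht hyx h hE
  have hlow1 := fun h (k : ℕ) (E : Fin k → QMat) (hE : IsPOVM E) =>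
    blochEntropy_sqrt_le_condEntropy (t := mueller τ 3 3) hB hx1 hyx h hE
  rw [← heq] at hval1 hval3
  simp only [← heq] at hlow1 hlow3
  have hρ1 : condEntropy ρ (axisProjection V 1) = blochEntropy √(mueller τ 1 1 ^ 2
      + (mueller τ 0 3 * mueller τ 3 3) ^ 2) := by
    rw [axisProjection_eq_conj, ← condEntropy_localConj hU, ← hτ, hval1]
  have hρ3 : condEntropy ρ (axisProjection V 3) = blochEntropy |mueller τ 3 3| := by
    rw [axisProjection_eq_conj, ← condEntropy_localConj hU, ← hτ, hval3]
  have ht2 := sq_abs (mueller τ 3 3)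
  have hr := Real.sqrt_nonneg (mueller τ 1 1 ^ 2 + (mueller τ 0 3 * mueller τ 3 3) ^ 2)
  constructor
  · intro h
    have hlt : mueller τ 1 1 ^ 2 < mueller τ 3 3 ^ 2 * (1 - mueller τ 0 3 ^ 2) := by
      rw [← hx, ← ht2]
      exact mul_lt_mul_of_pos_right (pow_lt_pow_left₀ h hx0 two_ne_zero) hm2
    obtain ⟨h1, h2, h3⟩ := optimal_of_forall_le hU hV hτ hX hd isPOVM_axisProjection_one_three
      hval3 (hlow3 hlt.le)
    refine ⟨h1, ?_, h2, h3⟩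
    -- The comparison x² < t²(1 - m²) of semi-axes is the same as x² + m²t² < t², a comparison of
    -- the two Bloch radii.
    have hrt : √(mueller τ 1 1 ^ 2 + (mueller τ 0 3 * mueller τ 3 3) ^ 2) < |mueller τ 3 3| := by
      rw [← Real.sqrt_sq_eq_abs]
      exact Real.sqrt_lt_sqrt (by positivity) (by linarith)
    rw [hρ1, hρ3]
    exact blochEntropy_strictAntiOn ⟨hr, hrt.le.trans ht⟩ ⟨abs_nonneg _, ht⟩ hrt
  · intro h
    have hlt : mueller τ 3 3 ^ 2 * (1 - mueller τ 0 3 ^ 2) < mueller τ 1 1 ^ 2 := by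
      rw [← hx, ← ht2]
      exact mul_lt_mul_of_pos_right (pow_lt_pow_left₀ h (abs_nonneg _) two_ne_zero) hm2
    obtain ⟨h1, h2, h3⟩ := optimal_of_forall_le hU hV hτ hX hd isPOVM_axisProjection_one_one
      hval1 (hlow1 hlt)
    refine ⟨h1, ?_, h2, h3⟩
    have hrt : |mueller τ 3 3| < √(mueller τ 1 1 ^ 2 + (mueller τ 0 3 * mueller τ 3 3) ^ 2) :=
      Real.lt_sqrt_of_sq_lt (by rw [ht2]; linarith)
    -- Here x² ≤ 1 - m² and m²t² ≤ m².
    have hr1 : √(mueller τ 1 1 ^ 2 + (mueller τ 0 3 * mueller τ 3 3) ^ 2) ≤ 1 := by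
      refine Real.sqrt_le_one.2 ?_
      have : mueller τ 3 3 ^ 2 ≤ 1 := by rw [← ht2]; exact pow_le_one₀ (abs_nonneg _) ht
      have := mul_le_mul_of_nonneg_left this (sq_nonneg (mueller τ 0 3))
      linarith [mul_pow (mueller τ 0 3) (mueller τ 3 3) 2]
    rw [hρ1, hρ3]
    exact blochEntropy_strictAntiOn ⟨abs_nonneg _, ht⟩ ⟨hr, hr1⟩ hrt
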